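/- Let $k$ be an algebraically closed field, let $S=k[[\alpha_1,\dots,\alpha_n]]$ with maximal ideal $\mathfrak m$, and let $P\subset \operatorname{Hom}_k(S,k)$ be the space of functionals vanishing on $\mathfrak m^D$ for all $D\gg 0$. It has as basis the divided power monomials $x^{[\mathbf a]}$, $\mathbf a\in\mathbb{Z}_{\ge 0}^n$, dual to the monomials $\alpha^{\mathbf a}$; the monomial $x^{[\mathbf a]}$ has degree $\sum_i a_i$. For $f\in P$ let $f_{\ge e}$ denote the sum of the terms of $f$ of degree at least $e$. The ring $S$ acts on $P$ by contraction, $(\sigma\lrcorner f)(\tau)=f(\tau\sigma)$, and one puts $\operatorname{Ann}(f)=\{\sigma\in S : \sigma\lrcorner f=0\}$ and $\operatorname{Apolar}(f)=S/\operatorname{Ann}(f)$. A local $k$-algebra $A=S/I$ with maximal ideal $\mathfrak m_A$ and socle degree $s=\max\{i : \mathfrak m_A^i\neq 0\}$ is called compressed if $$\dim_k \mathfrak m_A^i/\mathfrak m_A^{i+1}=\min\left(\binom{i+n-1}{i},\binom{s-i+n-1}{s-i}\right)\qquad\text{for all } 0\le i\le s.$$ Let $f\in P$ have degree $d\ge 3$,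 and assume that the characteristic of $k$ is $0$ or greater than $d$. If $\operatorname{Apolar}(f)$ is compressed, then there is an isomorphism of $k$-algebras $$\operatorname{Apolar}(f)\simeq \operatorname{Apolar}\bigl(f_{\ge \lfloor d/2\rfloor+2}\bigr).$$ -/

import Mathlib

noncomputable section

namespace Apolarity

/-- The power series ring `S = k[[α₁, …, αₙ]]`. -/
abbrev PS (k : Type*) [Field k] (n : ℕ) : Type _ := MvPowerSeries (Fin n) k

/-- The maximal ideal `𝔪` of `S`. -/
abbrev mm (k : Type*) [Field k] (n : ℕ) : Ideal (PS k n) :=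
  IsLocalRing.maximalIdeal (PS k n)

/-- The divided power module `P ⊆ Hom_k(S, k)`: the functionals `f` that vanish on `𝔪 ^ D` for
all sufficiently large `D`.  The pairing `⟨σ, f⟩` of `σ : S` with `f : P` is `f.1 σ`. -/
def DP (k : Type*) [Field k] (n : ℕ) : Submodule k (Module.Dual k (PS k n)) where
  carrier := {f | ∃ D₀ : ℕ, ∀ D ≥ D₀, ∀ σ ∈ mm k n ^ D, f σ = 0}
  zero_mem' := ⟨0, fun _ _ _ _ => rfl⟩
  add_mem' := by
    rintro f g ⟨D₁, h₁⟩ ⟨D₂, h₂⟩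
    refine ⟨max D₁ D₂, fun D hD σ hσ => ?_⟩
    rw [LinearMap.add_apply, h₁ D (le_trans (le_max_left _ _) hD) σ hσ,
      h₂ D (le_trans (le_max_right _ _) hD) σ hσ, add_zero]
  smul_mem' := by
    rintro c f ⟨D₁, h₁⟩
    refine ⟨D₁, fun D hD σ hσ => ?_⟩
    rw [LinearMap.smul_apply, h₁ D hD σ hσ, smul_zero]

variable {k : Type*} [Field k] {n : ℕ}

/-- Contraction `σ ⌟ f`, determined by `⟨τ, σ ⌟ f⟩ = ⟨τ σ, f⟩` for all `τ : S`. -/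
def contract (σ : PS k n) (f : DP k n) : DP k n :=
  ⟨f.1.comp (LinearMap.mulRight k σ), by
    obtain ⟨D₀, h⟩ := f.2
    exact ⟨D₀, fun D hD τ hτ => h D hD _ (Ideal.mul_mem_right _ _ hτ)⟩⟩

theorem contract_apply (σ τ : PS k n) (f : DP k n) : (contract σ f).1 τ = f.1 (τ * σ) := rfl

/-- The apolar ideal `Ann(f) = {σ ∈ S | σ ⌟ f = 0}`. -/
def Ann (f : DP k n) : Ideal (PS k n) where
  carrier := {σ | contract σ f = 0}
  zero_mem' := by
    apply Subtype.ext
    apply LinearMap.ext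
    intro τ
    simp [contract_apply]
  add_mem' := by
    intro σ₁ σ₂ h₁ h₂
    apply Subtype.ext
    apply LinearMap.ext
    intro τ
    have e₁ : f.1 (τ * σ₁) = 0 := by
      rw [← contract_apply, show contract σ₁ f = 0 from h₁]; rfl
    have e₂ : f.1 (τ * σ₂) = 0 := by
      rw [← contract_apply, show contract σ₂ f = 0 from h₂]; rfl
    rw [contract_apply, mul_add, map_add, e₁, e₂, add_zero]; rfl
  smul_mem' := by
    intro ρ σ h
    apply Subtype.ext
    apply LinearMap.ext
    intro τ
    have e : f.1 (τ * ρ * σ) = 0 := by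
      rw [← contract_apply, show contract σ f = 0 from h]; rfl
    rw [contract_apply, smul_eq_mul, ← mul_assoc, e]; rfl

/-- The apolar algebra `Apolar(f) = S / Ann(f)`. -/
abbrev Apolar (f : DP k n) : Type _ := PS k n ⧸ Ann f

theorem coeff_eq_zero_of_mem_mm_pow {D : ℕ} {σ : PS k n} (hσ : σ ∈ mm k n ^ D)
    (a : Fin n →₀ ℕ) (ha : a.degree < D) : MvPowerSeries.coeff a σ = 0 := by
  suffices h : ∀ D : ℕ, ∀ σ ∈ mm k n ^ D, (D : ℕ∞) ≤ σ.order by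
    exact MvPowerSeries.coeff_of_lt_order (lt_of_lt_of_le (by exact_mod_cast ha) (h D σ hσ))
  intro D
  induction D with
  | zero => intro σ _; simp
  | succ D ih =>
    intro σ hσ
    rw [pow_succ] at hσ
    refine Submodule.mul_induction_on hσ (fun x hx y hy => ?_) (fun x y hx hy => ?_)
    · refine le_trans ?_ MvPowerSeries.le_order_mul
      have h1 : (1 : ℕ∞) ≤ y.order := by
        rw [MvPowerSeries.one_le_order_iff_constCoeff_eq_zero]
        by_contra hne
        exact (IsLocalRing.mem_maximalIdeal _).1 hy
          (MvPowerSeries.isUnit_iff_constantCoeff.2 (isUnit_iff_ne_zero.2 hne))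
      rw [Nat.cast_succ]
      exact add_le_add (ih x hx) h1
    · exact le_trans (le_min hx hy) MvPowerSeries.min_order_le_add

/-- The divided power monomial `x^[a]`, dual to `α^a`: `⟨α^b, x^[a]⟩ = δ_{ab}`, i.e.
`⟨σ, x^[a]⟩` is the coefficient of `α^a` in `σ`. -/
def dpMonomial (a : Fin n →₀ ℕ) : DP k n :=
  ⟨MvPowerSeries.coeff a, a.degree + 1, fun _ hD _ hσ => coeff_eq_zero_of_mem_mm_pow hσ a hD⟩

/-- The coefficient `⟨α^a, f⟩` of `x^[a]` in `f`. -/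
def coeff (a : Fin n →₀ ℕ) (f : DP k n) : k := f.1 (MvPowerSeries.monomial a 1)

/-- `f` has degree `d`: the largest total degree of a divided power monomial with nonzero
coefficient in `f` exists and equals `d` (in particular `f ≠ 0`). -/
def HasDegree (f : DP k n) (d : ℕ) : Prop :=
  IsGreatest {m : ℕ | ∃ a : Fin n →₀ ℕ, a.degree = m ∧ coeff a f ≠ 0} d

/-- The linear map on `S` that deletes all terms of degree `< e`. -/
def dropLow (e : ℕ) : PS k n →ₗ[k] PS k n where
  toFun σ := fun a => if e ≤ a.degree then MvPowerSeries.coeff a σ else 0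
  map_add' σ τ := by
    refine MvPowerSeries.ext fun a => ?_
    change (if e ≤ a.degree then MvPowerSeries.coeff a (σ + τ) else 0) =
      (if e ≤ a.degree then MvPowerSeries.coeff a σ else 0) +
        (if e ≤ a.degree then MvPowerSeries.coeff a τ else 0)
    split_ifs <;> simp
  map_smul' c σ := by
    refine MvPowerSeries.ext fun a => ?_
    change (if e ≤ a.degree then MvPowerSeries.coeff a (c • σ) else 0) =
      c • (if e ≤ a.degree then MvPowerSeries.coeff a σ else 0)
    split_ifs <;> simp

theorem coeff_dropLow (e : ℕ) (σ : PS k n) (a : Fin n →₀ ℕ) :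
    MvPowerSeries.coeff a (dropLow e σ) =
      if e ≤ a.degree then MvPowerSeries.coeff a σ else 0 := rfl

/-- The part `f_{≥ e}` of `f`: the sum of the terms of `f` of degree at least `e`.  It is given by
pairing `f` with the part of degree `≥ e` of a power series; see `partGE_dpMonomial` and
`coeff_partGE`. -/
def partGE (e : ℕ) (f : DP k n) : DP k n :=
  ⟨f.1.comp (dropLow e), by
    obtain ⟨D₀, h⟩ := f.2
    refine ⟨max D₀ e, fun D hD σ hσ => ?_⟩
    have hs : dropLow e σ = σ := by
      refine MvPowerSeries.ext fun a => ?_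
      rw [coeff_dropLow]
      split_ifs with ha
      · rfl
      · exact (coeff_eq_zero_of_mem_mm_pow hσ a
          (lt_of_lt_of_le (not_le.1 ha) (le_trans (le_max_right _ _) hD))).symm
    rw [LinearMap.comp_apply, hs]
    exact h D (le_trans (le_max_left _ _) hD) σ hσ⟩

theorem partGE_dpMonomial (e : ℕ) (a : Fin n →₀ ℕ) :
    partGE e (dpMonomial a : DP k n) = if e ≤ a.degree then dpMonomial a else 0 := by
  apply Subtype.ext
  apply LinearMap.ext
  intro σ
  change MvPowerSeries.coeff a (dropLow e σ) = _
  rw [coeff_dropLow]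
  split_ifs <;> rfl

theorem coeff_partGE (e : ℕ) (a : Fin n →₀ ℕ) (f : DP k n) :
    coeff a (partGE e f) = if e ≤ a.degree then coeff a f else 0 := by
  classical
  change f.1 (dropLow e (MvPowerSeries.monomial a 1)) = _
  by_cases h : e ≤ a.degree
  · rw [if_pos h]
    congr 1
    refine MvPowerSeries.ext fun b => ?_
    rw [coeff_dropLow, MvPowerSeries.coeff_monomial]
    by_cases hb : b = a
    · subst hb; simp [h]
    · simp [hb]
  · rw [if_neg h]
    have h0 : dropLow e (MvPowerSeries.monomial a (1 : k)) = 0 := by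
      refine MvPowerSeries.ext fun b => ?_
      rw [coeff_dropLow, MvPowerSeries.coeff_monomial]
      by_cases hb : b = a
      · subst hb; simp [h]
      · simp [hb]
    rw [h0, map_zero]

end Apolarity

namespace Apolarity

/-- The Hilbert function `H_A(i) = dim_k 𝔪_A ^ i / 𝔪_A ^ (i + 1)` of a local `k`-algebra `A`. -/
def hilbertFn (k A : Type*) [Field k] [CommRing A] [IsLocalRing A] [Algebra k A] (i : ℕ) : ℕ :=
  Module.finrank k
    (↥(IsLocalRing.maximalIdeal A ^ i) ⧸
      Submodule.comap (IsLocalRing.maximalIdeal A ^ i).subtype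
        (IsLocalRing.maximalIdeal A ^ (i + 1)))

/-- `d` is the socle degree of the local ring `A`: the largest `i` with `𝔪_A ^ i ≠ 0`. -/
def IsSocleDegree (A : Type*) [CommRing A] [IsLocalRing A] (d : ℕ) : Prop :=
  IsGreatest {i : ℕ | IsLocalRing.maximalIdeal A ^ i ≠ ⊥} d

/-- `A`, a quotient of the power series ring `S` in `n` variables over `k`, is a compressed local
algebra: it is local, has a socle degree `d`, and
`H_A(i) = min (H_S(i), H_S(d - i)) = min (binom(i+n-1, i), binom(d-i+n-1, d-i))` for `0 ≤ i ≤ d`.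
(For `n = 0` the truncated subtraction gives the correct values `H_S(0) = 1` and `H_S(i) = 0` for
`i > 0`.) -/
def IsCompressed (k : Type*) (n : ℕ) (A : Type*) [Field k] [CommRing A] [Algebra k A] : Prop :=
  ∃ _ : IsLocalRing A, ∃ d : ℕ, IsSocleDegree A d ∧ ∀ i ≤ d,
    hilbertFn k A i =
      min (Nat.choose (i + n - 1) i) (Nat.choose (d - i + n - 1) (d - i))

end Apolarity

end

/-!
Let `f` have degree `d` and write `m = ⌊d/2⌋`. Compressedness prescribes the last `m + 1` values of
the Hilbert function of `Apolar(f)`, and these add up to the dimension of the space `P_{≤ m}` of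
functionals of degree at most `m`; hence the inclusion `𝔪 ^ (d - m) ⌟ f ⊆ P_{≤ m}` is an equality.
In particular there are `D_i ∈ 𝔪 ^ (d - m)` with `D_i ⌟ f = -(m + 1)⁻¹ • α_i ⌟ f_{m+1}`, where
`f_{m+1}` is the component of degree `m + 1`.

Let `φ` be the automorphism `α_i ↦ α_i + D_i` of `S` and `δ` the derivation `∑ D_i ∂_i`. In degrees
at least `m + 2`, composing `f` with `φ` changes nothing, for degree reasons. In degree `m + 1` only
the first-order change `f ∘ δ` survives, and by Euler's identity it is `-f_{m+1}`. So `f ∘ φ` agrees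
with `f_{≥ m+2}` up to `P_{≤ m}`. Undoing `φ`, the functional `f_{≥ m+2} ∘ φ⁻¹` differs from `f` by
an element of `P_{≤ m}`, which is `ρ ⌟ f` for some `ρ ∈ 𝔪`; it equals `(1 - ρ) ⌟ f`, and since
`1 - ρ` is a unit it has the same annihilator as `f`.
-/

noncomputable section

namespace Apolarity

section PowerSeries

theorem mem_span_range_X_pow_iff {ι R : Type*} [Finite ι] [CommRing R] {D : ℕ}
    {σ : MvPowerSeries ι R} :
    σ ∈ Ideal.span (Set.range MvPowerSeries.X) ^ D ↔
      ∀ a : ι →₀ ℕ, a.degree < D → MvPowerSeries.coeff a σ = 0 := by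
  let I := MvPolynomial.idealOfVars ι R
  let e := (MvPowerSeries.toAdicCompletionAlgEquiv ι R).toLinearEquiv
  have map_vars : I.map (algebraMap _ (MvPowerSeries ι R)) =
      Ideal.span (Set.range MvPowerSeries.X) := by
    rw [Ideal.map_span, ← Set.range_comp]
    congr 2
    ext1 i
    simp [MvPowerSeries.algebraMap_apply']
  have mem_iff : σ ∈ (I ^ D • ⊤ : Submodule (MvPolynomial ι R) (MvPowerSeries ι R)) ↔
      e σ ∈ (I ^ D • ⊤ : Submodule (MvPolynomial ι R) (AdicCompletion I (MvPolynomial ι R))) := by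
    rw [← LinearEquiv.range e, ← Submodule.map_top, ← Submodule.map_smul'',
      Submodule.mem_map_equiv, e.symm_apply_apply]
  have eval_e : AdicCompletion.eval I (MvPolynomial ι R) D (e σ) =
      Submodule.Quotient.mk (MvPowerSeries.truncTotal D σ) := rfl
  rw [← map_vars, ← Ideal.map_pow, ← Submodule.restrictScalars_mem (MvPolynomial ι R),
    ← Ideal.smul_top_eq_map, mem_iff,
    AdicCompletion.pow_smul_top_eq_ker_eval (MvPolynomial.idealOfVars_fg ι R), LinearMap.mem_ker,
    eval_e, Submodule.Quotient.mk_eq_zero, smul_eq_mul, Ideal.mul_top,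
    MvPolynomial.mem_pow_idealOfVars_iff']
  refine forall₂_congr fun a ha => ?_
  rw [MvPowerSeries.coeff_truncTotal _ ha]

variable {k : Type*} [Field k] {n : ℕ}

theorem mem_mm_iff {σ : PS k n} : σ ∈ mm k n ↔ MvPowerSeries.constantCoeff σ = 0 := by
  rw [IsLocalRing.mem_maximalIdeal, mem_nonunits_iff, MvPowerSeries.isUnit_iff_constantCoeff,
    isUnit_iff_ne_zero, not_not]

theorem mm_eq_span_X : mm k n = Ideal.span (Set.range MvPowerSeries.X) := by
  ext σ
  rw [← pow_one (Ideal.span _), mem_span_range_X_pow_iff, mem_mm_iff]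
  simp [Finsupp.degree_eq_zero_iff]

theorem mem_mm_pow_iff {D : ℕ} {σ : PS k n} :
    σ ∈ mm k n ^ D ↔ ∀ a : Fin n →₀ ℕ, a.degree < D → MvPowerSeries.coeff a σ = 0 := by
  rw [mm_eq_span_X, mem_span_range_X_pow_iff]

theorem monomial_mem_mm_pow (a : Fin n →₀ ℕ) (c : k) :
    (MvPowerSeries.monomial a c : PS k n) ∈ mm k n ^ a.degree := by
  classical
  refine mem_mm_pow_iff.2 fun b hb => ?_
  rw [MvPowerSeries.coeff_monomial, if_neg (by rintro rfl; exact hb.false)]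

theorem X_mem_mm (i : Fin n) : (MvPowerSeries.X i : PS k n) ∈ mm k n :=
  mem_mm_iff.2 (MvPowerSeries.constantCoeff_X i)

theorem eq_zero_of_forall_mem_mm_pow {σ : PS k n} (h : ∀ j, σ ∈ mm k n ^ j) : σ = 0 :=
  MvPowerSeries.ext fun a => mem_mm_pow_iff.1 (h (a.degree + 1)) a (Nat.lt_succ_self _)

/-- Truncation reduces the claim to polynomials, i.e. to finitely many monomials. -/
theorem mem_of_forall_monomial_mem {W : Submodule k (PS k n)} {N : ℕ}
    (hN : (mm k n ^ N).restrictScalars k ≤ W) {j : ℕ}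
    (hW : ∀ a : Fin n →₀ ℕ, j ≤ a.degree → MvPowerSeries.monomial a 1 ∈ W)
    {σ : PS k n} (hσ : σ ∈ mm k n ^ j) : σ ∈ W := by
  have tail_mem : σ - (MvPowerSeries.truncTotal N σ : MvPolynomial (Fin n) k) ∈ W := by
    refine hN (mem_mm_pow_iff.2 fun a ha => ?_)
    rw [map_sub, MvPolynomial.coeff_coe, MvPowerSeries.coeff_truncTotal _ ha, sub_self]
  have head_mem : ((MvPowerSeries.truncTotal N σ : MvPolynomial (Fin n) k) : PS k n) ∈ W := by
    rw [MvPolynomial.as_sum (MvPowerSeries.truncTotal N σ),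
      ← MvPolynomial.coeToMvPowerSeries.ringHom_apply, map_sum]
    refine sum_mem fun a ha => ?_
    have le_degree : j ≤ a.degree := by
      by_contra! h
      rw [MvPolynomial.mem_support_iff, MvPowerSeries.coeff_truncTotal_eq_ite,
        mem_mm_pow_iff.1 hσ a h, ite_self] at ha
      exact ha rfl
    rw [MvPolynomial.coeToMvPowerSeries.ringHom_apply, MvPolynomial.coe_monomial, ← mul_one
      (MvPolynomial.coeff _ _), ← smul_eq_mul, map_smul]
    exact W.smul_mem _ (hW a le_degree)
  rw [← sub_add_cancel σ (MvPowerSeries.truncTotal N σ : MvPolynomial (Fin n) k)]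
  exact add_mem tail_mem head_mem

end PowerSeries

section LowDegree

variable {k : Type*} [Field k] {n : ℕ}

theorem card_degree_lt (n D : ℕ) :
    Nat.card {a : Fin n →₀ ℕ // a.degree < D} =
      ∑ i ∈ Finset.range D, Nat.choose (i + n - 1) i := by
  have mem_iff : ∀ a : Fin n →₀ ℕ, a ∈ (Finset.range D).biUnion
      (fun i => (Finset.univ : Finset (Fin n)).finsuppAntidiag i) ↔ a.degree < D := by
    simp [Finsupp.degree_eq_sum]
  have disjoint : (Finset.range D : Set ℕ).PairwiseDisjoint
      (fun i => (Finset.univ : Finset (Fin n)).finsuppAntidiag i) := fun i _ j _ hij =>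
    Finset.disjoint_left.2 fun a hi hj =>
      hij ((Finset.mem_finsuppAntidiag.1 hi).1.symm.trans (Finset.mem_finsuppAntidiag.1 hj).1)
  rw [← Nat.card_congr (Equiv.subtypeEquivRight mem_iff), Nat.card_eq_fintype_card,
    Fintype.card_coe, Finset.card_biUnion disjoint]
  refine Finset.sum_congr rfl fun i _ => ?_
  rw [Finset.card_finsuppAntidiag_nat_eq_choose, Finset.card_fin, add_comm n i]

/-- The functionals of degree at most `m`, encoded as those vanishing on `𝔪 ^ (m + 1)`; see
`mem_degreeLE_iff_coeff`. -/
def degreeLE (k : Type*) [Field k] (n m : ℕ) : Submodule k (Module.Dual k (PS k n)) :=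
  ((mm k n ^ (m + 1)).restrictScalars k).dualAnnihilator

theorem mem_degreeLE_iff {m : ℕ} {g : Module.Dual k (PS k n)} :
    g ∈ degreeLE k n m ↔ ∀ σ ∈ mm k n ^ (m + 1), g σ = 0 :=
  Submodule.mem_dualAnnihilator g

theorem mem_degreeLE_iff_coeff {m : ℕ} {g : DP k n} :
    g.1 ∈ degreeLE k n m ↔ ∀ a : Fin n →₀ ℕ, m < a.degree → coeff a g = 0 := by
  rw [mem_degreeLE_iff]
  refine ⟨fun hg a ha => hg _ (Ideal.pow_le_pow_right ha (monomial_mem_mm_pow a 1)),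
    fun hg σ hσ => ?_⟩
  obtain ⟨N, hN⟩ := g.2
  exact mem_of_forall_monomial_mem (W := LinearMap.ker g.1) (hN N le_rfl) hg hσ

theorem HasDegree.mem_degreeLE {f : DP k n} {d : ℕ} (hf : HasDegree f d) :
    f.1 ∈ degreeLE k n d :=
  mem_degreeLE_iff_coeff.2 fun a ha => by_contra fun hne => ha.not_ge (hf.2 ⟨a, rfl, hne⟩)

theorem exists_mem_degreeLE (f : DP k n) : ∃ m, f.1 ∈ degreeLE k n m := by
  obtain ⟨N, hN⟩ := f.2
  exact ⟨N, mem_degreeLE_iff.2 (hN (N + 1) N.le_succ)⟩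

theorem contract_mem_degreeLE {m j : ℕ} {f : DP k n} (hf : f.1 ∈ degreeLE k n (m + j))
    {σ : PS k n} (hσ : σ ∈ mm k n ^ j) : (contract σ f).1 ∈ degreeLE k n m := by
  refine mem_degreeLE_iff.2 fun τ hτ => mem_degreeLE_iff.1 hf (τ * σ) ?_
  rw [Nat.add_right_comm, pow_add]
  exact Ideal.mul_mem_mul hτ hσ

/-- The values of a functional of degree at most `m` on the monomials of degree at most `m`: its
coordinates in the basis of divided power monomials. -/
def degreeLECoeffs (k : Type*) [Field k] (n m : ℕ) :
    degreeLE k n m →ₗ[k] ({a : Fin n →₀ ℕ // a.degree < m + 1} → k) :=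
  LinearMap.pi fun a => LinearMap.applyₗ (MvPowerSeries.monomial a.1 1) ∘ₗ (degreeLE k n m).subtype

theorem degreeLECoeffs_injective (m : ℕ) : Function.Injective (degreeLECoeffs k n m) := by
  refine (injective_iff_map_eq_zero _).2 fun g hg => Subtype.ext (LinearMap.ext fun σ => ?_)
  suffices σ ∈ LinearMap.ker g.1 from this
  refine mem_of_forall_monomial_mem (N := m + 1) (j := 0) (fun τ hτ => mem_degreeLE_iff.1 g.2 τ hτ)
    (fun a _ => ?_) (by simp)
  by_cases ha : a.degree < m + 1
  · exact congrFun hg ⟨a, ha⟩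
  · exact mem_degreeLE_iff.1 g.2 _ (Ideal.pow_le_pow_right (not_lt.1 ha) (monomial_mem_mm_pow a 1))

instance finite_degree_lt (D : ℕ) : Finite {a : Fin n →₀ ℕ // a.degree < D} :=
  (Finsupp.finite_of_degree_lt (σ := Fin n) D).to_subtype

instance finiteDimensional_degreeLE (m : ℕ) : FiniteDimensional k (degreeLE k n m) :=
  FiniteDimensional.of_injective _ (degreeLECoeffs_injective m)

theorem finrank_degreeLE_le (m : ℕ) :
    Module.finrank k (degreeLE k n m) ≤ ∑ i ∈ Finset.range (m + 1), Nat.choose (i + n - 1) i := by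
  cases nonempty_fintype {a : Fin n →₀ ℕ // a.degree < m + 1}
  rw [← card_degree_lt, Nat.card_eq_fintype_card, ← Module.finrank_fintype_fun_eq_card k]
  exact LinearMap.finrank_le_finrank_of_injective (degreeLECoeffs_injective m)

end LowDegree

section LocalAlgebra

theorem finrank_map_eq_of_ker_eq {K V W W' : Type*} [Field K] [AddCommGroup V] [Module K V]
    [AddCommGroup W] [Module K W] [AddCommGroup W'] [Module K W'] {g : V →ₗ[K] W} {h : V →ₗ[K] W'}
    (hgh : LinearMap.ker g = LinearMap.ker h) (U : Submodule K V) :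
    Module.finrank K (U.map g) = Module.finrank K (U.map h) := by
  rw [← LinearMap.range_domRestrict, ← LinearMap.range_domRestrict,
    ← (g.domRestrict U).quotKerEquivRange.finrank_eq,
    ← (h.domRestrict U).quotKerEquivRange.finrank_eq, LinearMap.ker_domRestrict,
    LinearMap.ker_domRestrict, hgh]

variable {k A : Type*} [Field k] [CommRing A] [IsLocalRing A] [Algebra k A]

theorem finrank_maximalIdeal_pow [FiniteDimensional k A] (i : ℕ) :
    Module.finrank k ↥(IsLocalRing.maximalIdeal A ^ i) =
      hilbertFn k A i + Module.finrank k ↥(IsLocalRing.maximalIdeal A ^ (i + 1)) := by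
  have pow_succ_le : IsLocalRing.maximalIdeal A ^ (i + 1) ≤ IsLocalRing.maximalIdeal A ^ i :=
    Ideal.pow_le_pow_right i.le_succ
  let N := Submodule.comap (IsLocalRing.maximalIdeal A ^ i).subtype
    (IsLocalRing.maximalIdeal A ^ (i + 1))
  have finite_pow : FiniteDimensional k ↥(IsLocalRing.maximalIdeal A ^ i) :=
    inferInstanceAs (FiniteDimensional k ↥((IsLocalRing.maximalIdeal A ^ i).restrictScalars k))
  have finrank_N : Module.finrank k ↥(N.restrictScalars k) =
      Module.finrank k ↥(IsLocalRing.maximalIdeal A ^ (i + 1)) :=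
    ((Submodule.comapSubtypeEquivOfLe pow_succ_le).restrictScalars k).finrank_eq
  rw [← Submodule.finrank_quotient_add_finrank (N.restrictScalars k), finrank_N,
    (Submodule.Quotient.restrictScalarsEquiv k N).finrank_eq]
  rfl

theorem finrank_maximalIdeal_pow_eq_sum_add [FiniteDimensional k A] (i j : ℕ) :
    Module.finrank k ↥(IsLocalRing.maximalIdeal A ^ i) =
      ∑ l ∈ Finset.range j, hilbertFn k A (i + l) +
        Module.finrank k ↥(IsLocalRing.maximalIdeal A ^ (i + j)) := by
  induction j with
  | zero => simp
  | succ j ih =>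
    rw [ih, Finset.sum_range_succ, finrank_maximalIdeal_pow (i + j), add_assoc, add_assoc]

end LocalAlgebra

section Apolar

variable {k : Type*} [Field k] {n : ℕ}

theorem mem_Ann_iff {f : DP k n} {σ : PS k n} : σ ∈ Ann f ↔ ∀ τ, f.1 (τ * σ) = 0 :=
  ⟨fun h τ => congrArg (fun g : DP k n => g.1 τ) h, fun h => Subtype.ext (LinearMap.ext h)⟩

theorem Ann_contract_of_isUnit {u : PS k n} (hu : IsUnit u) (f : DP k n) :
    Ann (contract u f) = Ann f := by
  ext σ
  rw [← Ideal.mul_unit_mem_iff_mem (Ann f) hu, mem_Ann_iff, mem_Ann_iff]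
  simp only [contract_apply, mul_assoc]

/-- The linear map `σ ↦ σ ⌟ f`, with values in all of `Hom_k(S, k)`. -/
def contractHom (f : DP k n) : PS k n →ₗ[k] Module.Dual k (PS k n) :=
  (LinearMap.mul k (PS k n)).flip.compr₂ f.1

theorem ker_contractHom (f : DP k n) :
    LinearMap.ker (contractHom f) = (Ann f).restrictScalars k := by
  ext σ
  exact ⟨fun h => Subtype.ext h, fun h => congrArg Subtype.val h⟩

instance finiteDimensional_apolar (f : DP k n) : FiniteDimensional k (Apolar f) := by
  obtain ⟨m, hm⟩ := exists_mem_degreeLE f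
  have range_le : LinearMap.range (contractHom f) ≤ degreeLE k n m := by
    rintro _ ⟨σ, rfl⟩
    exact contract_mem_degreeLE (j := 0) hm (by simp)
  have := Submodule.finiteDimensional_of_le range_le
  have := Module.Finite.equiv (contractHom f).quotKerEquivRange.symm
  rw [ker_contractHom] at this
  exact this

theorem maximalIdeal_apolar_pow (f : DP k n) [IsLocalRing (Apolar f)] (i : ℕ) :
    IsLocalRing.maximalIdeal (Apolar f) ^ i = (mm k n ^ i).map (Ideal.Quotient.mk (Ann f)) := by
  rw [Ideal.map_pow, IsLocalRing.map_maximalIdeal_of_surjective _ Ideal.Quotient.mk_surjective]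

theorem maximalIdeal_apolar_pow_eq_bot_iff {f : DP k n} [IsLocalRing (Apolar f)] {i : ℕ} :
    IsLocalRing.maximalIdeal (Apolar f) ^ i = ⊥ ↔ ∀ σ ∈ mm k n ^ i, f.1 σ = 0 := by
  rw [maximalIdeal_apolar_pow, Ideal.map_eq_bot_iff_le_ker, Ideal.mk_ker]
  refine ⟨fun h σ hσ => ?_, fun h σ hσ => mem_Ann_iff.2 fun τ => h _ (Ideal.mul_mem_left _ τ hσ)⟩
  rw [← one_mul σ]
  exact mem_Ann_iff.1 (h hσ) 1

theorem HasDegree.isSocleDegree {f : DP k n} {d : ℕ} (hf : HasDegree f d)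
    [IsLocalRing (Apolar f)] : IsSocleDegree (Apolar f) d := by
  refine ⟨fun h => ?_, fun e he => not_lt.1 fun hlt => he ?_⟩
  · obtain ⟨a, rfl, ha⟩ := hf.1
    exact ha (maximalIdeal_apolar_pow_eq_bot_iff.1 h _ (monomial_mem_mm_pow a 1))
  · exact maximalIdeal_apolar_pow_eq_bot_iff.2 fun σ hσ =>
      mem_degreeLE_iff.1 hf.mem_degreeLE σ (Ideal.pow_le_pow_right hlt hσ)

theorem finrank_maximalIdeal_apolar_pow (f : DP k n) [IsLocalRing (Apolar f)] (i : ℕ) :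
    Module.finrank k ↥(IsLocalRing.maximalIdeal (Apolar f) ^ i) =
      Module.finrank k (((mm k n ^ i).restrictScalars k).map (contractHom f)) := by
  let q : PS k n →ₗ[k] Apolar f := (Ideal.Quotient.mkₐ k (Ann f)).toLinearMap
  have pow_eq : (IsLocalRing.maximalIdeal (Apolar f) ^ i).restrictScalars k =
      ((mm k n ^ i).restrictScalars k).map q := by
    ext x
    rw [maximalIdeal_apolar_pow]
    exact Ideal.mem_map_iff_of_surjective _ Ideal.Quotient.mk_surjective
  have ker_q : LinearMap.ker q = LinearMap.ker (contractHom f) := by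
    rw [ker_contractHom]
    ext σ
    exact Ideal.Quotient.eq_zero_iff_mem
  rw [← finrank_map_eq_of_ker_eq ker_q, ← pow_eq]
  rfl

theorem map_contractHom_eq_degreeLE {f : DP k n} {d m : ℕ} (hmd : m ≤ d) (hf : HasDegree f d)
    [IsLocalRing (Apolar f)]
    (hH : ∀ i ≤ m, hilbertFn k (Apolar f) (d - i) = Nat.choose (i + n - 1) i) :
    ((mm k n ^ (d - m)).restrictScalars k).map (contractHom f) = degreeLE k n m := by
  have le_degreeLE :
      ((mm k n ^ (d - m)).restrictScalars k).map (contractHom f) ≤ degreeLE k n m := by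
    rintro _ ⟨σ, hσ, rfl⟩
    refine contract_mem_degreeLE ?_ hσ
    rw [Nat.add_sub_cancel' hmd]
    exact hf.mem_degreeLE
  refine Submodule.eq_of_le_of_finrank_le le_degreeLE ?_
  calc Module.finrank k (degreeLE k n m)
      ≤ ∑ i ∈ Finset.range (m + 1), Nat.choose (i + n - 1) i := finrank_degreeLE_le m
    _ = ∑ i ∈ Finset.range (m + 1), hilbertFn k (Apolar f) (d - i) :=
        Finset.sum_congr rfl fun i hi => (hH i (Nat.lt_succ_iff.1 (Finset.mem_range.1 hi))).symm
    _ = ∑ i ∈ Finset.range (m + 1), hilbertFn k (Apolar f) (d - m + i) := by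
        rw [← Finset.sum_range_reflect]
        refine Finset.sum_congr rfl fun i hi => congrArg _ ?_
        rw [Finset.mem_range] at hi
        omega
    _ ≤ Module.finrank k ↥(IsLocalRing.maximalIdeal (Apolar f) ^ (d - m)) := by
        rw [finrank_maximalIdeal_pow_eq_sum_add (d - m) (m + 1)]
        exact Nat.le_add_right _ _
    _ = Module.finrank k (((mm k n ^ (d - m)).restrictScalars k).map (contractHom f)) :=
        finrank_maximalIdeal_apolar_pow f _

theorem choose_add_sub_one_mono (hn : n ≠ 0) : Monotone fun i => Nat.choose (i + n - 1) i := by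
  obtain ⟨n, rfl⟩ := Nat.exists_eq_succ_of_ne_zero hn
  intro i j h
  simp only [Nat.add_succ_sub_one, Nat.choose_symm_add]
  exact Nat.choose_le_choose _ (Nat.add_le_add_right h n)

theorem HasDegree.ne_zero {f : DP k n} {d : ℕ} (hf : HasDegree f d) (hd : d ≠ 0) : n ≠ 0 := by
  rintro rfl
  obtain ⟨a, rfl, -⟩ := hf.1
  exact hd (by rw [Subsingleton.elim a 0, map_zero])

theorem IsCompressed.hilbertFn_sub_eq {f : DP k n} {d : ℕ} (hA : IsCompressed k n (Apolar f))
    (hf : HasDegree f d) :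
    ∃ _ : IsLocalRing (Apolar f), ∀ i, 2 * i ≤ d →
      hilbertFn k (Apolar f) (d - i) = Nat.choose (i + n - 1) i := by
  obtain ⟨hloc, e, he, hH⟩ := hA
  obtain rfl := he.unique hf.isSocleDegree
  refine ⟨hloc, fun i hi => ?_⟩
  rw [hH _ (e.sub_le i), Nat.sub_sub_self (by omega), min_eq_right]
  rcases eq_or_ne e 0 with rfl | he0
  · obtain rfl : i = 0 := by omega
    rfl
  · exact choose_add_sub_one_mono (hf.ne_zero he0) (by omega)

end Apolar

section Endomorphism

theorem exponent_induction {ι : Type*} {p : (ι →₀ ℕ) → Prop} (a : ι →₀ ℕ) (zero : p 0)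
    (single_one : ∀ i, p (Finsupp.single i 1)) (add : ∀ a b, p a → p b → p (a + b)) : p a := by
  refine Finsupp.induction_linear a zero add fun i c => ?_
  induction c with
  | zero => rwa [Finsupp.single_zero]
  | succ c ih => exact Finsupp.single_add i c 1 ▸ add _ _ ih (single_one i)

variable {k : Type*} [Field k] {n : ℕ}

theorem map_mem_mm (φ : PS k n →ₐ[k] PS k n) {σ : PS k n} (hσ : σ ∈ mm k n) : φ σ ∈ mm k n := by
  let ε : PS k n →+* k := MvPowerSeries.constantCoeff.comp φ.toRingHom
  have ε_surjective : Function.Surjective ε := fun c =>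
    ⟨algebraMap k (PS k n) c, by
      change MvPowerSeries.constantCoeff (φ (algebraMap k (PS k n) c)) = c
      rw [AlgHom.commutes, MvPowerSeries.algebraMap_apply, Algebra.algebraMap_self_apply,
        MvPowerSeries.constantCoeff_C]⟩
  have ker_ε : RingHom.ker ε = mm k n :=
    IsLocalRing.eq_maximalIdeal (RingHom.ker_isMaximal_of_surjective ε ε_surjective)
  rw [← ker_ε] at hσ
  exact mem_mm_iff.2 hσ

theorem map_mem_mm_pow (φ : PS k n →ₐ[k] PS k n) {j : ℕ} {σ : PS k n} (hσ : σ ∈ mm k n ^ j) :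
    φ σ ∈ mm k n ^ j := by
  have map_pow_le : (mm k n ^ j).map φ ≤ mm k n ^ j := by
    rw [Ideal.map_pow]
    exact Ideal.pow_right_mono (Ideal.map_le_iff_le_comap.2 fun _ => map_mem_mm φ) j
  exact map_pow_le (Ideal.mem_map_of_mem φ hσ)

theorem mul_mem_mm_pow {i j l : ℕ} (hl : i + j = l) {σ τ : PS k n} (hσ : σ ∈ mm k n ^ i)
    (hτ : τ ∈ mm k n ^ j) : σ * τ ∈ mm k n ^ l := by
  rw [← hl, pow_add]
  exact Ideal.mul_mem_mul hσ hτ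

theorem monomial_add_one (a b : Fin n →₀ ℕ) :
    (MvPowerSeries.monomial (a + b) 1 : PS k n) =
      MvPowerSeries.monomial a 1 * MvPowerSeries.monomial b 1 := by
  rw [MvPowerSeries.monomial_mul_monomial, one_mul]

section NearIdentity

variable {φ : PS k n →ₐ[k] PS k n} {t : ℕ}

theorem map_monomial_sub_self_mem
    (hφ : ∀ i, φ (MvPowerSeries.X i) - MvPowerSeries.X i ∈ mm k n ^ (t + 1)) (a : Fin n →₀ ℕ) :
    φ (MvPowerSeries.monomial a 1) - MvPowerSeries.monomial a 1 ∈ mm k n ^ (a.degree + t) := by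
  induction a using exponent_induction with
  | zero => simp
  | single_one i =>
    rw [Finsupp.degree_single, add_comm 1 t]
    exact hφ i
  | add a b ha hb =>
    set x : PS k n := MvPowerSeries.monomial a 1
    set y : PS k n := MvPowerSeries.monomial b 1
    have leibniz : φ (x * y) - x * y = (φ x - x) * φ y + x * (φ y - y) := by
      rw [map_mul]
      ring
    rw [monomial_add_one, leibniz, map_add]
    exact add_mem
      (mul_mem_mm_pow (by omega) ha (map_mem_mm_pow φ (monomial_mem_mm_pow b 1)))
      (mul_mem_mm_pow (by omega) (monomial_mem_mm_pow a 1) hb)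

theorem map_sub_self_mem_mm_pow
    (hφ : ∀ i, φ (MvPowerSeries.X i) - MvPowerSeries.X i ∈ mm k n ^ (t + 1)) {j : ℕ} {σ : PS k n}
    (hσ : σ ∈ mm k n ^ j) : φ σ - σ ∈ mm k n ^ (j + t) := by
  suffices σ ∈ ((mm k n ^ (j + t)).restrictScalars k).comap (φ.toLinearMap - LinearMap.id) from this
  refine mem_of_forall_monomial_mem (N := j + t) (fun τ hτ => ?_) (fun a ha => ?_) hσ
  · exact sub_mem (map_mem_mm_pow φ hτ) hτ
  · exact Ideal.pow_le_pow_right (by omega) (map_monomial_sub_self_mem hφ a)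

/-- The error is of second order in `δ`, so it gains a `t` over `map_monomial_sub_self_mem`. -/
theorem map_monomial_sub_self_sub_derivation_mem {δ : Derivation k (PS k n) (PS k n)}
    (hφ : ∀ i, φ (MvPowerSeries.X i) = MvPowerSeries.X i + δ (MvPowerSeries.X i))
    (hδ : ∀ i, δ (MvPowerSeries.X i) ∈ mm k n ^ (t + 1)) (a : Fin n →₀ ℕ) :
    φ (MvPowerSeries.monomial a 1) - MvPowerSeries.monomial a 1 - δ (MvPowerSeries.monomial a 1) ∈
      mm k n ^ (a.degree + 2 * t) := by
  have first_order := map_monomial_sub_self_mem (φ := φ) (t := t) fun i => by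
    rw [hφ, add_sub_cancel_left]
    exact hδ i
  induction a using exponent_induction with
  | zero => simp
  | single_one i =>
    rw [← MvPowerSeries.X_def, hφ, add_sub_cancel_left, sub_self]
    exact zero_mem _
  | add a b ha hb =>
    set x : PS k n := MvPowerSeries.monomial a 1
    set y : PS k n := MvPowerSeries.monomial b 1
    have expand : φ (x * y) - x * y - δ (x * y) =
        (φ x - x - δ x) * y + x * (φ y - y - δ y) + (φ x - x) * (φ y - y) := by
      rw [map_mul, Derivation.leibniz, smul_eq_mul, smul_eq_mul]
      ring
    rw [monomial_add_one, expand, map_add]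
    exact add_mem (add_mem
      (mul_mem_mm_pow (by omega) ha (monomial_mem_mm_pow b 1))
      (mul_mem_mm_pow (by omega) (monomial_mem_mm_pow a 1) hb))
      (mul_mem_mm_pow (by omega) (first_order a) (first_order b))

theorem injective_of_map_X_sub_X_mem
    (hφ : ∀ i, φ (MvPowerSeries.X i) - MvPowerSeries.X i ∈ mm k n ^ 2) :
    Function.Injective φ := by
  refine (injective_iff_map_eq_zero φ).2 fun σ hσ => eq_zero_of_forall_mem_mm_pow fun j => ?_
  induction j with
  | zero => simp
  | succ j ih => simpa only [hσ, zero_sub, neg_mem_iff] using map_sub_self_mem_mm_pow (t := 1) hφ ih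

theorem map_mm_eq_of_map_X_sub_X_mem
    (hφ : ∀ i, φ (MvPowerSeries.X i) - MvPowerSeries.X i ∈ mm k n ^ 2) :
    (mm k n).map φ.toRingHom = mm k n := by
  refine le_antisymm (Ideal.map_le_iff_le_comap.2 fun _ => map_mem_mm φ) ?_
  refine Submodule.le_of_le_smul_of_le_jacobson_bot (IsNoetherian.noetherian _)
    (IsLocalRing.maximalIdeal_le_jacobson ⊥) ?_
  nth_rw 1 [mm_eq_span_X]
  refine Ideal.span_le.2 ?_
  rintro _ ⟨i, rfl⟩
  rw [← sub_sub_cancel (φ (MvPowerSeries.X i)) (MvPowerSeries.X i)]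
  refine sub_mem (Submodule.mem_sup_left ?_) (Submodule.mem_sup_right ?_)
  · exact Ideal.mem_map_of_mem φ.toRingHom (X_mem_mm i)
  · rw [smul_eq_mul, ← pow_two]
    exact hφ i

theorem surjective_of_map_X_sub_X_mem
    (hφ : ∀ i, φ (MvPowerSeries.X i) - MvPowerSeries.X i ∈ mm k n ^ 2) :
    Function.Surjective φ := by
  have complete : IsAdicComplete (mm k n) (PS k n) := by
    rw [mm_eq_span_X]
    infer_instance
  have hausdorff : IsHausdorff ((mm k n).map φ.toRingHom) (PS k n) := by
    rw [map_mm_eq_of_map_X_sub_X_mem hφ]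
    infer_instance
  refine surjective_of_mk_map_comp_surjective (I := mm k n) φ.toRingHom fun y => ?_
  obtain ⟨σ, rfl⟩ := Ideal.Quotient.mk_surjective y
  refine ⟨algebraMap k (PS k n) (MvPowerSeries.constantCoeff σ), Ideal.Quotient.eq.2 ?_⟩
  rw [map_mm_eq_of_map_X_sub_X_mem hφ, mem_mm_iff]
  change MvPowerSeries.constantCoeff (φ (algebraMap k (PS k n) _) - σ) = 0
  rw [AlgHom.commutes, map_sub, MvPowerSeries.algebraMap_apply, Algebra.algebraMap_self_apply,
    MvPowerSeries.constantCoeff_C, sub_self]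

end NearIdentity

theorem exists_derivation_X_eq (D : Fin n → PS k n) :
    ∃ δ : Derivation k (PS k n) (PS k n), ∀ i, δ (MvPowerSeries.X i) = D i := by
  refine ⟨∑ j, D j • MvPowerSeries.pderiv k j, fun i => ?_⟩
  have apply_sum : (∑ j, D j • MvPowerSeries.pderiv k j) (MvPowerSeries.X i) =
      ∑ j, (D j • MvPowerSeries.pderiv k j) (MvPowerSeries.X i) :=
    map_sum ((Pi.evalAddMonoidHom (fun _ => PS k n) _).comp Derivation.coeFnAddMonoidHom) _ _
  rw [apply_sum, Finset.sum_eq_single i]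
  · rw [Derivation.smul_apply, MvPowerSeries.pderiv_X_self, smul_eq_mul, mul_one]
  · intro j _ hj
    rw [Derivation.smul_apply, MvPowerSeries.pderiv_X_of_ne hj.symm, smul_zero]
  · simp

theorem exists_algEquiv_X_eq {E : Fin n → PS k n}
    (hE : ∀ i, E i - MvPowerSeries.X i ∈ mm k n ^ 2) :
    ∃ φ : PS k n ≃ₐ[k] PS k n, ∀ i, φ (MvPowerSeries.X i) = E i := by
  have hasSubst : MvPowerSeries.HasSubst E := MvPowerSeries.hasSubst_of_constantCoeff_zero fun i =>
    mem_mm_iff.1 <| by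
      rw [← sub_add_cancel (E i) (MvPowerSeries.X i)]
      exact add_mem (Ideal.pow_le_self two_ne_zero (hE i)) (X_mem_mm i)
  have subst_X : ∀ i, MvPowerSeries.substAlgHom (R := k) hasSubst (MvPowerSeries.X i) = E i :=
    MvPowerSeries.substAlgHom_X hasSubst
  have near_id : ∀ i, MvPowerSeries.substAlgHom (R := k) hasSubst (MvPowerSeries.X i) -
      MvPowerSeries.X i ∈ mm k n ^ 2 := fun i => subst_X i ▸ hE i
  exact ⟨AlgEquiv.ofBijective (MvPowerSeries.substAlgHom hasSubst)
    ⟨injective_of_map_X_sub_X_mem near_id, surjective_of_map_X_sub_X_mem near_id⟩, subst_X⟩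

end Endomorphism

section Pullback

variable {k : Type*} [Field k] {n : ℕ}

/-- The functional `f ∘ φ`: the transpose of the automorphism `φ` of `S`, acting on divided
powers. -/
def pullback (φ : PS k n ≃ₐ[k] PS k n) (f : DP k n) : DP k n :=
  ⟨f.1 ∘ₗ φ.toLinearMap, by
    obtain ⟨D₀, h⟩ := f.2
    exact ⟨D₀, fun D hD σ hσ => h D hD _ (map_mem_mm_pow φ.toAlgHom hσ)⟩⟩

theorem pullback_apply (φ : PS k n ≃ₐ[k] PS k n) (f : DP k n) (σ : PS k n) :
    (pullback φ f).1 σ = f.1 (φ σ) := rfl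

theorem mem_Ann_pullback {φ : PS k n ≃ₐ[k] PS k n} {f : DP k n} {σ : PS k n} :
    σ ∈ Ann (pullback φ f) ↔ φ σ ∈ Ann f := by
  simp only [mem_Ann_iff, pullback_apply, map_mul]
  exact (φ.surjective.forall (p := fun τ => f.1 (τ * φ σ) = 0)).symm

/-- The isomorphism of apolar algebras induced by an automorphism of `S`. -/
def apolarPullbackEquiv (φ : PS k n ≃ₐ[k] PS k n) (f : DP k n) :
    Apolar (pullback φ f) ≃ₐ[k] Apolar f :=
  Ideal.quotientEquivAlg _ _ φ <| by
    refine (Ideal.ext fun σ => ?_ : Ann (pullback φ f) = (Ann f).comap φ.toRingHom) ▸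
      (Ideal.map_comap_of_surjective _ φ.surjective _).symm
    exact mem_Ann_pullback

theorem pullback_mem_degreeLE (φ : PS k n ≃ₐ[k] PS k n) {m : ℕ} {f : DP k n}
    (hf : f.1 ∈ degreeLE k n m) : (pullback φ f).1 ∈ degreeLE k n m :=
  mem_degreeLE_iff.2 fun _ hσ => mem_degreeLE_iff.1 hf _ (map_mem_mm_pow φ.toAlgHom hσ)

theorem coeff_pullback {φ : PS k n ≃ₐ[k] PS k n} {f : DP k n} {d t : ℕ}
    (hf : f.1 ∈ degreeLE k n d)
    (hφ : ∀ i, φ (MvPowerSeries.X i) - MvPowerSeries.X i ∈ mm k n ^ (t + 1)) {a : Fin n →₀ ℕ}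
    (ha : d < a.degree + t) : coeff a (pullback φ f) = coeff a f := by
  have apply_error := mem_degreeLE_iff.1 hf _ <| Ideal.pow_le_pow_right ha <|
    map_monomial_sub_self_mem (φ := φ.toAlgHom) hφ a
  rw [map_sub] at apply_error
  exact sub_eq_zero.1 apply_error

theorem coeff_pullback_eq_add_apply_derivation {φ : PS k n ≃ₐ[k] PS k n}
    {δ : Derivation k (PS k n) (PS k n)} {f : DP k n} {d t : ℕ} (hf : f.1 ∈ degreeLE k n d)
    (hφ : ∀ i, φ (MvPowerSeries.X i) = MvPowerSeries.X i + δ (MvPowerSeries.X i))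
    (hδ : ∀ i, δ (MvPowerSeries.X i) ∈ mm k n ^ (t + 1)) {a : Fin n →₀ ℕ}
    (ha : d < a.degree + 2 * t) :
    coeff a (pullback φ f) = coeff a f + f.1 (δ (MvPowerSeries.monomial a 1)) := by
  have apply_error := mem_degreeLE_iff.1 hf _ <| Ideal.pow_le_pow_right ha <|
    map_monomial_sub_self_sub_derivation_mem (φ := φ.toAlgHom) hφ hδ a
  rw [sub_sub, map_sub, map_add] at apply_error
  exact sub_eq_zero.1 apply_error

/-- The homogeneous component of degree `e` of `f`. -/
def component (e : ℕ) (f : DP k n) : DP k n := partGE e f - partGE (e + 1) f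

theorem coeff_component (e : ℕ) (a : Fin n →₀ ℕ) (f : DP k n) :
    coeff a (component e f) = if a.degree = e then coeff a f else 0 := by
  change coeff a (partGE e f) - coeff a (partGE (e + 1) f) = _
  rw [coeff_partGE, coeff_partGE]
  rcases lt_trichotomy a.degree e with h | h | h
  · rw [if_neg (by omega), if_neg (by omega), if_neg (by omega), sub_self]
  · rw [if_pos (by omega), if_neg (by omega), if_pos h, sub_zero]
  · rw [if_pos (by omega), if_pos (by omega), if_neg (by omega), sub_self]

theorem component_mem_degreeLE (e : ℕ) (f : DP k n) : (component e f).1 ∈ degreeLE k n e :=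
  mem_degreeLE_iff_coeff.2 fun a ha => by rw [coeff_component, if_neg ha.ne']

/-- Euler's identity, if `δ` is the Euler field `∑ α_i ∂_i`, `f = g` and `c = 1`. -/
theorem apply_mul_derivation_monomial {δ : Derivation k (PS k n) (PS k n)} {f g : DP k n} {c : k}
    (hδ : ∀ i, contract (δ (MvPowerSeries.X i)) f = c • contract (MvPowerSeries.X i) g)
    (a : Fin n →₀ ℕ) : ∀ τ : PS k n, f.1 (τ * δ (MvPowerSeries.monomial a 1)) =
      c * a.degree * g.1 (τ * MvPowerSeries.monomial a 1) := by
  induction a using exponent_induction with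
  | zero => simp
  | single_one i =>
    intro τ
    rw [Finsupp.degree_single, Nat.cast_one, mul_one, ← MvPowerSeries.X_def]
    exact congrArg (fun h : DP k n => h.1 τ) (hδ i)
  | add a b ha hb =>
    intro τ
    set x : PS k n := MvPowerSeries.monomial a 1
    set y : PS k n := MvPowerSeries.monomial b 1
    calc f.1 (τ * δ (MvPowerSeries.monomial (a + b) 1))
        = f.1 (τ * x * δ y) + f.1 (τ * y * δ x) := by
          rw [monomial_add_one, Derivation.leibniz, smul_eq_mul, smul_eq_mul, mul_add, map_add,
            mul_assoc, mul_assoc]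
      _ = c * b.degree * g.1 (τ * x * y) + c * a.degree * g.1 (τ * y * x) := by rw [hb, ha]
      _ = c * (a + b).degree * g.1 (τ * MvPowerSeries.monomial (a + b) 1) := by
          rw [monomial_add_one, mul_right_comm τ y x, mul_assoc τ x y, map_add, Nat.cast_add]
          ring

theorem exists_derivation_contract_eq {f g : DP k n} {m j : ℕ} (c : k)
    (hf : degreeLE k n m ≤ ((mm k n ^ j).restrictScalars k).map (contractHom f))
    (hg : g.1 ∈ degreeLE k n (m + 1)) :
    ∃ δ : Derivation k (PS k n) (PS k n), (∀ i, δ (MvPowerSeries.X i) ∈ mm k n ^ j) ∧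
      ∀ i, contract (δ (MvPowerSeries.X i)) f = c • contract (MvPowerSeries.X i) g := by
  have contract_X_mem : ∀ i, (contract (MvPowerSeries.X i) g).1 ∈ degreeLE k n m := fun i =>
    contract_mem_degreeLE hg ((pow_one (mm k n)).symm ▸ X_mem_mm i)
  choose D D_mem hD using fun i => hf ((degreeLE k n m).smul_mem c (contract_X_mem i))
  obtain ⟨δ, hδ⟩ := exists_derivation_X_eq D
  exact ⟨δ, fun i => (hδ i).symm ▸ D_mem i, fun i => Subtype.ext ((hδ i).symm ▸ hD i)⟩

theorem exists_algEquiv_pullback_sub_partGE_mem {f : DP k n} {m t : ℕ} (ht : 1 ≤ t)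
    (hm : ((m + 1 : ℕ) : k) ≠ 0) (hf : f.1 ∈ degreeLE k n (m + t + 1))
    (hcontract : degreeLE k n m ≤ ((mm k n ^ (t + 1)).restrictScalars k).map (contractHom f)) :
    ∃ φ : PS k n ≃ₐ[k] PS k n, (pullback φ f - partGE (m + 2) f).1 ∈ degreeLE k n m := by
  obtain ⟨δ, δ_mem, hδ⟩ := exists_derivation_contract_eq (-((m + 1 : ℕ) : k)⁻¹) hcontract
    (component_mem_degreeLE (m + 1) f)
  obtain ⟨φ, hφ⟩ := exists_algEquiv_X_eq
    (E := fun i => MvPowerSeries.X i + δ (MvPowerSeries.X i)) fun i => by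
      rw [add_sub_cancel_left]
      exact Ideal.pow_le_pow_right (by omega) (δ_mem i)
  have φ_X_sub_mem : ∀ i, φ (MvPowerSeries.X i) - MvPowerSeries.X i ∈ mm k n ^ (t + 1) :=
    fun i => by rw [hφ, add_sub_cancel_left]; exact δ_mem i
  refine ⟨φ, mem_degreeLE_iff_coeff.2 fun a ha => ?_⟩
  change coeff a (pullback φ f) - coeff a (partGE (m + 2) f) = 0
  rw [coeff_partGE]
  rcases (Nat.succ_le_of_lt ha).eq_or_lt with ha_eq | ha_lt
  · have euler : f.1 (δ (MvPowerSeries.monomial a 1)) = -coeff a f := by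
      have := apply_mul_derivation_monomial hδ a 1
      rw [one_mul, one_mul, ← ha_eq, neg_mul, inv_mul_cancel₀ hm, neg_one_mul] at this
      rw [this, ← coeff, coeff_component, if_pos ha_eq.symm]
    rw [coeff_pullback_eq_add_apply_derivation hf hφ δ_mem (by omega), euler, add_neg_cancel,
      if_neg (by omega), sub_zero]
  · rw [coeff_pullback hf φ_X_sub_mem (by omega), if_pos (by omega), sub_self]

theorem Ann_eq_of_sub_mem_map {f h : DP k n}
    (hfh : (f - h).1 ∈ ((mm k n).restrictScalars k).map (contractHom f)) : Ann h = Ann f := by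
  obtain ⟨ρ, hρ, hfh⟩ := hfh
  have isUnit_one_sub : IsUnit (1 - ρ) := IsLocalRing.isUnit_one_sub_self_of_mem_nonunits ρ hρ
  have h_eq : h = contract (1 - ρ) f := Subtype.ext <| LinearMap.ext fun τ => by
    rw [contract_apply, mul_sub, mul_one, map_sub]
    exact eq_sub_of_add_eq (eq_sub_iff_add_eq'.1 (LinearMap.congr_fun hfh τ))
  rw [h_eq, Ann_contract_of_isUnit isUnit_one_sub]

theorem nonempty_apolar_algEquiv_partGE {f : DP k n} {m t : ℕ} (ht : 1 ≤ t)
    (hm : ((m + 1 : ℕ) : k) ≠ 0) (hf : f.1 ∈ degreeLE k n (m + t + 1))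
    (hcontract : degreeLE k n m ≤ ((mm k n ^ (t + 1)).restrictScalars k).map (contractHom f)) :
    Nonempty (Apolar f ≃ₐ[k] Apolar (partGE (m + 2) f)) := by
  obtain ⟨φ, hφ⟩ := exists_algEquiv_pullback_sub_partGE_mem ht hm hf hcontract
  let h := pullback φ.symm (partGE (m + 2) f)
  have sub_h_eq : f - h = pullback φ.symm (pullback φ f - partGE (m + 2) f) :=
    Subtype.ext <| LinearMap.ext fun σ => congrArg (f.1 · - h.1 σ) (φ.apply_symm_apply σ).symm
  have sub_h_mem : (f - h).1 ∈ ((mm k n).restrictScalars k).map (contractHom f) := by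
    refine Submodule.map_mono ?_ (hcontract (sub_h_eq ▸ pullback_mem_degreeLE φ.symm hφ))
    exact Ideal.pow_le_self t.succ_ne_zero
  exact ⟨(Ideal.quotientEquivAlgOfEq k (Ann_eq_of_sub_mem_map sub_h_mem).symm).trans
    (apolarPullbackEquiv φ.symm (partGE (m + 2) f))⟩

end Pullback

theorem natCast_ne_zero_of_ringChar {R : Type*} [NonAssocSemiring R] {d j : ℕ}
    (hR : ringChar R = 0 ∨ d < ringChar R) (hj : j ≠ 0) (hjd : j ≤ d) : (j : R) ≠ 0 := by
  rw [Ne, ringChar.spec]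
  rcases hR with hR | hR
  · rwa [hR, zero_dvd_iff]
  · exact Nat.not_dvd_of_pos_of_lt (Nat.pos_of_ne_zero hj) (hjd.trans_lt hR)

end Apolarity

end

theorem mainTheorem5_general {k : Type*} [Field k] {n d m : ℕ} (hmd : m + 2 ≤ d)
    (hm : ((m + 1 : ℕ) : k) ≠ 0) {f : Apolarity.DP k n} (hf : Apolarity.HasDegree f d)
    [IsLocalRing (Apolarity.Apolar f)]
    (hH : ∀ i ≤ m, Apolarity.hilbertFn k (Apolarity.Apolar f) (d - i) =
      Nat.choose (i + n - 1) i) :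
    Nonempty (Apolarity.Apolar f ≃ₐ[k] Apolarity.Apolar (Apolarity.partGE (m + 2) f)) := by
  obtain ⟨t, rfl⟩ := Nat.exists_eq_add_of_lt (show m < d by omega)
  have surjects := Apolarity.map_contractHom_eq_degreeLE (by omega) hf hH
  rw [add_assoc, Nat.add_sub_cancel_left] at surjects
  exact Apolarity.nonempty_apolar_algEquiv_partGE (by omega) hm hf.mem_degreeLE surjects.ge

theorem mainTheorem5 {k : Type*} [Field k] [IsAlgClosed k] (n d : ℕ) (hd : 3 ≤ d)
    (hchar : ringChar k = 0 ∨ d < ringChar k)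
    (f : Apolarity.DP k n) (hf : Apolarity.HasDegree f d)
    (hA : Apolarity.IsCompressed k n (Apolarity.Apolar f)) :
    Nonempty (Apolarity.Apolar f ≃ₐ[k] Apolarity.Apolar (Apolarity.partGE (d / 2 + 2) f)) := by
  obtain ⟨_, hH⟩ := hA.hilbertFn_sub_eq hf
  exact mainTheorem5_general (by omega)
    (Apolarity.natCast_ne_zero_of_ringChar hchar (Nat.succ_ne_zero _) (by omega)) hf
    fun i hi => hH i (by omega)
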